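/- Let $\mathfrak{A}=\left(\frac{-3,-1}{\mathbb{Q}}\right)$ be the rational quaternion algebra with standard generators $\mathtt{q},\mathtt{p}$ satisfying $\mathtt{q}^2=-3$, $\mathtt{p}^2=-1$, $\mathtt{p}\mathtt{q}=-\mathtt{q}\mathtt{p}$, let $\mathtt{r}=\frac12(1+\mathtt{q})$, and let $G_D=\langle \mathtt{r},\mathtt{p}\rangle\subseteq\mathfrak{A}^*$ be the dicyclic group. For an algebraic (possibly infinite) extension $E/\mathbb{Q}_\ell$, $\ell$ a prime, let $\mathcal{O}_E$ be the integral closure of $\mathbb{Z}_\ell$ in $E$, and let $e(E/\mathbb{Q}_\ell)\in\mathbb{N}\cup\{\infty\}$ be the ramification index, i.e. the index of the value group of $\mathbb{Q}_\ell$ in that of $E$. If $E$ splits $\mathfrak{A}$, i.e. $\mathfrak{A}_E=E\otimes_{\mathbb{Q}}\mathfrak{A}\cong\mathbb{M}_2(E)$, let $\rho:G_D\to\mathrm{GL}_2(E)$ be the representation obtained from the inclusion $G_D\subseteq\mathfrak{A}^*\subseteq\mathfrak{A}_E^*$ and any such isomorphism, and let $\mathrm{IF}_\rho^{G_D}(E)$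 be the set of $\mathrm{GL}_2(\mathcal{O}_E)$-conjugacy classes of homomorphisms $G_D\to\mathrm{GL}_2(\mathcal{O}_E)$ that are $\mathrm{GL}_2(E)$-conjugates of $\rho$. (1) Let $E$ be a Galois extension of $\mathbb{Q}_3$ containing a quadratic extension of $\mathbb{Q}_3$. Then $E$ splits $\mathfrak{A}$, and for every choice of the isomorphism $\mathfrak{A}_E\cong\mathbb{M}_2(E)$ the set $\mathrm{IF}_\rho^{G_D}(E)$ has exactly $e(E/\mathbb{Q}_3)+1$ elements if $\sqrt2\in E$ (that is, it is infinite if $e(E/\mathbb{Q}_3)=\infty$), and is a singleton if $\sqrt2\notin E$. (2) Let $\ell\neq3$ be a prime and let $E$ be any algebraic extension of $\mathbb{Q}_\ell$. Then $E$ splits $\mathfrak{A}$, and for every choice of the isomorphism $\mathfrak{A}_E\cong\mathbb{M}_2(E)$ the set $\mathrm{IF}_\rho^{G_D}(E)$ is a singleton. -/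

import Mathlib

open scoped Quaternion TensorProduct

/-! ### The dicyclic group -/

/-- The unit `r = (1 + q) / 2` of the rational quaternion algebra `(-3, -1 / ℚ)`, where `q` and `p`
are the standard generators: `q ^ 2 = -3`, `p ^ 2 = -1` and `p * q = - q * p`. The four coordinates
are those with respect to the basis `1, q, p, q * p`. -/
def dicyclicR : (ℍ[ℚ, -3, -1])ˣ where
  val := ⟨1 / 2, 1 / 2, 0, 0⟩
  inv := ⟨1 / 2, -1 / 2, 0, 0⟩
  val_inv := by ext <;> norm_num
  inv_val := by ext <;> norm_num

/-- The standard generator `p` of `(-3, -1 / ℚ)` with `p ^ 2 = -1`, as a unit. -/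
def dicyclicP : (ℍ[ℚ, -3, -1])ˣ where
  val := ⟨0, 0, 1, 0⟩
  inv := ⟨0, 0, -1, 0⟩
  val_inv := by ext <;> norm_num
  inv_val := by ext <;> norm_num

/-- The dicyclic group `G_D = ⟨r, p⟩`, a group of invertible quaternions. -/
def dicyclicGroup : Subgroup (ℍ[ℚ, -3, -1])ˣ :=
  Subgroup.closure {dicyclicR, dicyclicP}

/-- The representation `G_D → GL₂(E)` obtained by extension of scalars to `E`, once the quaternion
algebra over `E` has been identified with the matrix algebra by means of `φ`. -/
noncomputable def dicyclicRep {E : Type*} [Field E] [Algebra ℚ E]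
    (φ : (E ⊗[ℚ] ℍ[ℚ, -3, -1]) ≃ₐ[E] Matrix (Fin 2) (Fin 2) E) :
    dicyclicGroup →* GL (Fin 2) E :=
  (Units.map (φ.toAlgHom.toMonoidHom.comp
    (Algebra.TensorProduct.includeRight :
      ℍ[ℚ, -3, -1] →ₐ[ℚ] E ⊗[ℚ] ℍ[ℚ, -3, -1]).toMonoidHom)).comp dicyclicGroup.subtype

/-! ### Integral forms of a representation -/

section IntegralForms

variable {G F : Type*} [Group G] [Field F] {n : ℕ}

/-- The integral representations `G → GL_n(O)` that are `GL_n(F)`-conjugates of `ρ`. -/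
def IntegralRep (O : Subring F) (ρ : G →* GL (Fin n) F) :=
  {σ : G →* GL (Fin n) O //
    ∃ g : GL (Fin n) F, ∀ x : G,
      Matrix.GeneralLinearGroup.map O.subtype (σ x) = g * ρ x * g⁻¹}

/-- Conjugacy under `GL_n(O)`. -/
def integralRepSetoid (O : Subring F) (ρ : G →* GL (Fin n) F) : Setoid (IntegralRep O ρ) where
  r σ τ := ∃ h : GL (Fin n) O, ∀ x : G, τ.1 x = h * σ.1 x * h⁻¹
  iseqv :=
    { refl := fun _ => ⟨1, fun _ => by simp⟩
      symm := by
        rintro σ τ ⟨h, hh⟩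
        exact ⟨h⁻¹, fun x => by rw [hh x]; group⟩
      trans := by
        rintro σ τ υ ⟨h, hh⟩ ⟨k, hk⟩
        exact ⟨k * h, fun x => by rw [hk x, hh x]; group⟩ }

/-- The set of integral forms of `ρ`: the `GL_n(O)`-conjugacy classes of integral representations
that are `GL_n(F)`-conjugates of `ρ`. -/
def IntegralForms (O : Subring F) (ρ : G →* GL (Fin n) F) :=
  Quotient (integralRepSetoid O ρ)

end IntegralForms

/-! ### Algebraic extensions of `ℚ_p` -/

section Local

variable (p : ℕ) [Fact p.Prime] (E : Type*) [Field E] [Algebra ℚ_[p] E]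

/-- The ring of integers of an algebraic extension `E` of `ℚ_p`: the elements of `E` that are
integral over `ℤ_p`. -/
noncomputable def localIntegers : Subring E :=
  letI : Algebra ℤ_[p] E := ((algebraMap ℚ_[p] E).comp (algebraMap ℤ_[p] ℚ_[p])).toAlgebra
  (integralClosure ℤ_[p] E).toSubring

/-- The ramification index `e(E / ℚ_p)` of an algebraic extension `E` of `ℚ_p`: the index of the
value group of `ℚ_p` in that of `E`. As the value group of `E` is `Eˣ / O_Eˣ`, this is the number of
elements of `Eˣ / (O_Eˣ ℚ_pˣ)`. It may be infinite if `E / ℚ_p` is infinite. -/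
noncomputable def localRamificationIndex : ℕ∞ :=
  ENat.card (Eˣ ⧸
    ((Units.map (localIntegers p E).subtype.toMonoidHom).range ⊔
      (Units.map (algebraMap ℚ_[p] E).toMonoidHom).range))

end Local

/-!
A representation `G_D → GL₂` is the same thing as a pair of matrices satisfying the relations of
`r` and `p`. Integral forms of `ρ` exist over any valuation ring `O`, since a finite group
stabilises a lattice and lattices over `O` are free.

Two integral forms are intertwined by an integral matrix `N` having an entry `1`. If `N` is not
invertible, then the kernel of its reduction is an eigenline of both generators, so the residue
field itself contains a pair satisfying the relations. This forces `3 = 0` and yields a square root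
of `-1` in the residue field, which lifts to `E`. As `-2` is a square in `ℚ_3`, there is then a
square root of `2` in `E`. In all other cases the integral form is unique.

If `O` contains `1 / 2` and `√-1`, the matrix of `p` can be diagonalised over `O`, and that of `r`
then has constant diagonal `1 / 2` and off-diagonal entries `β / 2`, `γ / 2` with `β * γ = -3`. The
only remaining conjugations are diagonal, so the form is determined by the class of `β` up to units,
an arbitrary divisor of `3`. In the valuation ring of `E`, these divisors are `3` itself and the
elements not divisible by `3`, which represent the value group of `E` modulo that of `ℚ_3`.

The quaternion algebra splits over `E` as soon as `x ^ 2 + 3 * y ^ 2 = -1` is solvable in `E`.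
-/

/-- A pair of elements satisfying the relations of the generators `r` and `p` of the order `ℤ[r, p]`
of the quaternion algebra `(-3, -1 / ℚ)`. In characteristic `0`, pairs in a ring of matrices are the
same thing as representations of this algebra. -/
structure DicyclicPair {A : Type*} [Ring A] (r p : A) : Prop where
  r_mul_r : r * r = r - 1
  p_mul_p : p * p = -1
  p_mul_r : p * r = (1 - r) * p

namespace DicyclicPair

variable {A B : Type*} [Ring A] [Ring B] {r p : A}

theorem map (h : DicyclicPair r p) (f : A →+* B) : DicyclicPair (f r) (f p) where
  r_mul_r := by rw [← map_mul, h.r_mul_r, map_sub, map_one]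
  p_mul_p := by rw [← map_mul, h.p_mul_p, map_neg, map_one]
  p_mul_r := by rw [← map_mul, h.p_mul_r, map_mul, map_sub, map_one]

theorem of_map {f : A →+* B} (hf : Function.Injective f) (h : DicyclicPair (f r) (f p)) :
    DicyclicPair r p where
  r_mul_r := hf (by rw [map_mul, h.r_mul_r, map_sub, map_one])
  p_mul_p := hf (by rw [map_mul, h.p_mul_p, map_neg, map_one])
  p_mul_r := hf (by rw [map_mul, h.p_mul_r, map_mul, map_sub, map_one])

theorem conj (h : DicyclicPair r p) (u : Aˣ) : DicyclicPair (u * r * ↑u⁻¹) (u * p * ↑u⁻¹) := by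
  have conj_mul (x y : A) : u * x * ↑u⁻¹ * (u * y * ↑u⁻¹) = u * (x * y) * ↑u⁻¹ := by
    simp only [mul_assoc, Units.inv_mul_cancel_left]
  refine ⟨?_, ?_, ?_⟩
  · rw [conj_mul, h.r_mul_r, mul_sub, sub_mul, mul_one, Units.mul_inv]
  · rw [conj_mul, h.p_mul_p, mul_neg, neg_mul, mul_one, Units.mul_inv]
  · rw [conj_mul, h.p_mul_r, ← conj_mul, mul_sub, sub_mul, mul_one, Units.mul_inv]

theorem r_mul_one_sub_r (h : DicyclicPair r p) : r * (1 - r) = 1 := by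
  rw [mul_sub, h.r_mul_r, mul_one, sub_sub_cancel]

theorem r_pow_six (h : DicyclicPair r p) : r ^ 6 = 1 := by
  have r_pow_three : r ^ 3 = -1 := by
    rw [pow_succ, pow_two, h.r_mul_r, sub_mul, h.r_mul_r, one_mul, sub_sub_cancel_left]
  rw [show 6 = 3 * 2 from rfl, pow_mul, r_pow_three, neg_one_sq]

theorem p_pow_four (h : DicyclicPair r p) : p ^ 4 = 1 := by
  rw [show 4 = 2 * 2 from rfl, pow_mul, pow_two p, h.p_mul_p, neg_one_sq]

end DicyclicPair

theorem dicyclicPair_generators : DicyclicPair dicyclicR.1 dicyclicP.1 := by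
  constructor <;> ext <;> norm_num [dicyclicR, dicyclicP]

theorem finite_sup_of_le_normalizer {G : Type*} [Group G] {H K : Subgroup G} [Finite H] [Finite K]
    (hHK : H ≤ Subgroup.normalizer K) : Finite (H ⊔ K : Subgroup G) := by
  rw [← SetLike.coe_sort_coe, Subgroup.coe_mul_of_left_le_normalizer_right H K hHK]
  exact (Set.toFinite (H : Set G)).mul (Set.toFinite (K : Set G))

instance dicyclicGroup.instFinite : Finite dicyclicGroup := by
  have h := dicyclicPair_generators
  have finite_r : Finite (Subgroup.zpowers dicyclicR) := finite_zpowers.2 <|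
    isOfFinOrder_iff_pow_eq_one.2 ⟨6, by norm_num, Units.ext h.r_pow_six⟩
  have finite_p : Finite (Subgroup.zpowers dicyclicP) := finite_zpowers.2 <|
    isOfFinOrder_iff_pow_eq_one.2 ⟨4, by norm_num, Units.ext h.p_pow_four⟩
  have conj_r : MulAut.conj dicyclicP dicyclicR = dicyclicR⁻¹ := by
    refine mul_inv_eq_of_eq_mul (Units.ext (h.p_mul_r.trans ?_))
    rw [Units.val_mul, ← Units.inv_eq_of_mul_eq_one_right h.r_mul_one_sub_r]
  have p_normalizes : Subgroup.zpowers dicyclicP ≤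
      Subgroup.normalizer (Subgroup.zpowers dicyclicR) := by
    rw [Subgroup.zpowers_le]
    exact Subgroup.mem_normalizer_iff_map_conj_eq.2 (by
      rw [MonoidHom.map_zpowers, MonoidHom.coe_coe, conj_r, Subgroup.zpowers_inv])
  have sup_eq : dicyclicGroup = Subgroup.zpowers dicyclicP ⊔ Subgroup.zpowers dicyclicR := by
    rw [dicyclicGroup, Set.pair_comm, ← Set.singleton_union, Subgroup.closure_union,
      Subgroup.zpowers_eq_closure, Subgroup.zpowers_eq_closure]
  rw [sup_eq]
  exact finite_sup_of_le_normalizer p_normalizes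

namespace dicyclicGroup

/-- The generator `r` as an element of the dicyclic group. -/
def r : dicyclicGroup := ⟨dicyclicR, Subgroup.subset_closure (Set.mem_insert _ _)⟩

/-- The generator `p` as an element of the dicyclic group. -/
def p : dicyclicGroup := ⟨dicyclicP, Subgroup.subset_closure (Set.mem_insert_of_mem _ rfl)⟩

theorem closure_r_p : Subgroup.closure {r, p} = ⊤ := by
  refine Eq.trans ?_ (Subgroup.closure_closure_coe_preimage (k := {dicyclicR, dicyclicP}))
  congr 1
  ext x
  simp only [Set.mem_insert_iff, Set.mem_singleton_iff, Subtype.ext_iff, r, p]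
  rfl

theorem submonoid_closure_r_p : Submonoid.closure {r, p} = ⊤ := by
  rw [← Subgroup.closure_toSubmonoid_of_finite, closure_r_p, Subgroup.top_toSubmonoid]

theorem hom_ext {M : Type*} [Monoid M] {f g : dicyclicGroup →* M}
    (hr : f r = g r) (hp : f p = g p) : f = g := by
  refine MonoidHom.eq_of_eqOn_dense closure_r_p ?_
  rintro x (rfl | rfl)
  exacts [hr, hp]

end dicyclicGroup

section ValuationRing

variable {O K : Type*} [CommRing O] [IsDomain O] [ValuationRing O] [Field K] [Algebra O K]
  [IsFractionRing O K] {V : Type*} [AddCommGroup V] [Module K V] [Module O V] [IsScalarTower O K V]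

theorem free_of_isLattice (L : Submodule O V) [L.IsLattice K] : Module.Free O L := by
  have : Module.IsTorsionFree O V := Module.IsTorsionFree.trans_faithfulSMul O K V
  have : Module.Flat O L := Module.Flat.flat_iff_torsion_eq_bot_of_isBezout.2
    (Submodule.isTorsionFree_iff_torsion_eq_bot.1 inferInstance)
  exact Module.free_of_flat_of_isLocalRing

theorem exists_basis_span_eq_of_isLattice {ι : Type*} (b : Module.Basis ι K V)
    (L : Submodule O V) [L.IsLattice K] :
    ∃ c : Module.Basis ι K V, Submodule.span O (Set.range c) = L := by
  have := free_of_isLattice (K := K) L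
  let c := Module.Free.chooseBasis O L
  refine ⟨(c.extendOfIsLattice K).reindex ((c.extendOfIsLattice K).indexEquiv b), ?_⟩
  have range_eq : Set.range (c.extendOfIsLattice K) = L.subtype '' Set.range c := by
    rw [← Set.range_comp]
    exact congrArg Set.range (funext fun i => c.extendOfIsLattice_apply K i)
  rw [Module.Basis.range_reindex, range_eq, Submodule.span_image, c.span_eq, Submodule.map_top,
    Submodule.range_subtype]

end ValuationRing

section IntegralRep

variable {G F : Type*} [Group G] [Field F] {n : ℕ} {O : Subring F} {ρ : G →* GL (Fin n) F}

theorem IntegralRep.exists_of_mem_matrix (g : GL (Fin n) F)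
    (hg : ∀ x, (g * ρ x * g⁻¹).1 ∈ O.matrix) :
    ∃ σ : IntegralRep O ρ, ∀ x,
      Matrix.GeneralLinearGroup.map O.subtype (σ.1 x) = g * ρ x * g⁻¹ := by
  have injective : Function.Injective (O.subtype.mapMatrix (m := Fin n)) :=
    Matrix.map_injective Subtype.val_injective
  let f : G →* Matrix (Fin n) (Fin n) O :=
    { toFun x := .of fun i j => ⟨(g * ρ x * g⁻¹).1 i j, hg x i j⟩
      map_one' := injective <|
        (congrArg Units.val (by simp : g * ρ 1 * g⁻¹ = 1)).trans (map_one _).symm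
      map_mul' x y := injective <|
        (congrArg Units.val (by simp : g * ρ (x * y) * g⁻¹ = g * ρ x * g⁻¹ * (g * ρ y * g⁻¹))).trans
          (map_mul O.subtype.mapMatrix (.of fun i j => ⟨_, hg x i j⟩)
            (.of fun i j => ⟨_, hg y i j⟩)).symm }
  exact ⟨⟨f.toHomUnits, g, fun x => Units.ext rfl⟩, fun x => Units.ext rfl⟩

theorem span_orbit_isLattice [Finite G] (ρ : G →* GL (Fin n) F) :
    (Submodule.span O (Set.range fun y : G × Fin n => (ρ y.1).1.col y.2)).IsLattice F where
  fg := Submodule.fg_span (Set.finite_range _)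
  span_eq_top := by
    rw [Submodule.span_span_of_tower, eq_top_iff, ← (Pi.basisFun F (Fin n)).span_eq]
    refine Submodule.span_mono ?_
    rintro _ ⟨i, rfl⟩
    exact ⟨(1, i), by ext; simp [Matrix.one_apply, Pi.single_apply, eq_comm]⟩

theorem mulVec_mem_span_orbit (x : G) {v : Fin n → F}
    (hv : v ∈ Submodule.span O (Set.range fun y : G × Fin n => (ρ y.1).1.col y.2)) :
    (ρ x).1.mulVec v ∈ Submodule.span O (Set.range fun y : G × Fin n => (ρ y.1).1.col y.2) := by
  induction hv using Submodule.span_induction with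
  | zero => simp
  | add v w _ _ hv hw => rw [Matrix.mulVec_add]; exact add_mem hv hw
  | smul a v _ hv => rw [Matrix.mulVec_smul]; exact Submodule.smul_mem _ a hv
  | mem v hv =>
    obtain ⟨⟨y, i⟩, rfl⟩ := hv
    exact Submodule.subset_span
      ⟨(x * y, i), congrArg (fun M : GL (Fin n) F => M.1.col i) (map_mul ρ x y)⟩

theorem IntegralRep.nonempty_of_finite [Finite G] [ValuationRing O] [IsFractionRing O F]
    (ρ : G →* GL (Fin n) F) : Nonempty (IntegralRep O ρ) := by
  have := span_orbit_isLattice (O := O) ρ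
  obtain ⟨c, hc⟩ := exists_basis_span_eq_of_isLattice (Pi.basisFun F (Fin n))
    (Submodule.span O (Set.range fun y : G × Fin n => (ρ y.1).1.col y.2))
  let g : GL (Fin n) F := ⟨c.toMatrix (Pi.basisFun F (Fin n)), (Pi.basisFun F (Fin n)).toMatrix c,
    Module.Basis.toMatrix_mul_toMatrix_flip _ _, Module.Basis.toMatrix_mul_toMatrix_flip _ _⟩
  obtain ⟨σ, -⟩ := IntegralRep.exists_of_mem_matrix (O := O) (ρ := ρ) g fun x i j => by
    have coeff : (g * ρ x * g⁻¹).1 i j = c.repr ((ρ x).1.mulVec (c j)) i := by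
      have := congr($(basis_toMatrix_mul_linearMap_toMatrix_mul_basis_toMatrix c
        (Pi.basisFun F (Fin n)) c (Pi.basisFun F (Fin n)) (Matrix.toLin' (ρ x).1)) i j)
      rwa [LinearMap.toMatrix_apply, Matrix.toLin'_apply, LinearMap.toMatrix_eq_toMatrix',
        LinearMap.toMatrix'_toLin'] at this
    have mem : (ρ x).1.mulVec (c j) ∈ Submodule.span O (Set.range c) :=
      hc ▸ mulVec_mem_span_orbit x (hc ▸ Submodule.subset_span ⟨j, rfl⟩)
    obtain ⟨a, ha⟩ := (c.mem_span_iff_repr_mem O _).1 mem i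
    rw [coeff, ← ha]
    exact a.2
  exact ⟨σ⟩

end IntegralRep

/-- Simultaneous conjugacy of pairs of elements of a monoid under its group of units. -/
def IsConjPair {M : Type*} [Monoid M] (x y : M × M) : Prop :=
  ∃ g : Mˣ, SemiconjBy ↑g x.1 y.1 ∧ SemiconjBy ↑g x.2 y.2

namespace IsConjPair

variable {M : Type*} [Monoid M] {x y z : M × M}

theorem symm : IsConjPair x y → IsConjPair y x := fun ⟨g, h₁, h₂⟩ =>
  ⟨g⁻¹, h₁.units_inv_symm_left, h₂.units_inv_symm_left⟩

theorem trans : IsConjPair x y → IsConjPair y z → IsConjPair x z := fun ⟨g, h₁, h₂⟩ ⟨k, k₁, k₂⟩ =>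
  ⟨k * g, k₁.mul_left h₁, k₂.mul_left h₂⟩

end IsConjPair

namespace IntegralRep

variable {F : Type*} [Field F] {n : ℕ} {O : Subring F} {ρ : dicyclicGroup →* GL (Fin n) F}

/-- The images of the generators `r` and `p` of the dicyclic group, as matrices over `O`. -/
def generators (σ : IntegralRep O ρ) : Matrix (Fin n) (Fin n) O × Matrix (Fin n) (Fin n) O :=
  ((σ.1 dicyclicGroup.r).1, (σ.1 dicyclicGroup.p).1)

theorem setoid_iff_isConjPair_generators {σ τ : IntegralRep O ρ} :
    integralRepSetoid O ρ σ τ ↔ IsConjPair σ.generators τ.generators := by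
  refine exists_congr fun h => ⟨fun hστ => ?_, fun ⟨hr, hp⟩ => ?_⟩
  · have semiconj (x) : h * σ.1 x = τ.1 x * h := (eq_mul_inv_iff_mul_eq.1 (hστ x)).symm
    exact ⟨congrArg Units.val (semiconj _), congrArg Units.val (semiconj _)⟩
  · have : τ.1 = (MulAut.conj h).toMonoidHom.comp σ.1 := dicyclicGroup.hom_ext
      (eq_mul_inv_of_mul_eq (Units.ext hr.symm)) (eq_mul_inv_of_mul_eq (Units.ext hp.symm))
    exact DFunLike.congr_fun this

theorem dicyclicPair_generators (hρ : DicyclicPair (ρ dicyclicGroup.r).1 (ρ dicyclicGroup.p).1)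
    (σ : IntegralRep O ρ) : DicyclicPair σ.generators.1 σ.generators.2 := by
  obtain ⟨g, hg⟩ := σ.2
  refine DicyclicPair.of_map (f := O.subtype.mapMatrix)
    (Matrix.map_injective Subtype.val_injective) ?_
  have conj_eq (x) : O.subtype.mapMatrix (σ.1 x).1 = g.1 * (ρ x).1 * (g⁻¹).1 :=
    congrArg Units.val (hg x)
  rw [generators, conj_eq, conj_eq]
  exact hρ.conj g

end IntegralRep

theorem IntegralRep.exists_intertwiner {G F : Type*} [Group G] [Field F] {n : ℕ} {O : Subring F}
    {ρ : G →* GL (Fin n) F} (σ τ : IntegralRep O ρ) :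
    ∃ g : GL (Fin n) F, ∀ x, g * Matrix.GeneralLinearGroup.map O.subtype (σ.1 x) =
      Matrix.GeneralLinearGroup.map O.subtype (τ.1 x) * g := by
  obtain ⟨g, hg⟩ := σ.2
  obtain ⟨k, hk⟩ := τ.2
  exact ⟨k * g⁻¹, fun x => by rw [hg, hk]; group⟩

theorem dicyclicPair_dicyclicRep {E : Type*} [Field E] [Algebra ℚ E]
    (φ : (E ⊗[ℚ] ℍ[ℚ,-3,-1]) ≃ₐ[E] Matrix (Fin 2) (Fin 2) E) :
    DicyclicPair (dicyclicRep φ dicyclicGroup.r).1 (dicyclicRep φ dicyclicGroup.p).1 :=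
  dicyclicPair_generators.map (φ.toAlgHom.toRingHom.comp
    (Algebra.TensorProduct.includeRight : ℍ[ℚ,-3,-1] →ₐ[ℚ] E ⊗[ℚ] ℍ[ℚ,-3,-1]).toRingHom)

theorem DicyclicPair.of_eigenvector {k V : Type*} [Field k] [AddCommGroup V] [Module k V]
    {R P : Module.End k V} (h : DicyclicPair R P) {v : V} (hv : v ≠ 0) {a b : k}
    (ha : R v = a • v) (hb : P v = b • v) : DicyclicPair a b := by
  have inj := smul_left_injective k hv
  refine ⟨inj ?_, inj ?_, inj ?_⟩
  · simpa [ha, smul_smul, sub_smul] using congr($h.r_mul_r v)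
  · simpa [hb, smul_smul] using congr($h.p_mul_p v)
  · simpa [ha, hb, smul_smul, sub_smul, smul_sub, mul_sub, mul_comm] using congr($h.p_mul_r v)

theorem DicyclicPair.three_eq_zero {A : Type*} [CommRing A] {a b : A} (h : DicyclicPair a b) :
    (3 : A) = 0 := by
  linear_combination 4 * h.r_mul_r + (2 * a - 1) * b * h.p_mul_r - (2 * a - 1) ^ 2 * h.p_mul_p

theorem exists_common_eigenvector {k V W : Type*} [Field k] [AddCommGroup V] [Module k V]
    [AddCommGroup W] [Module k W] (hV : Module.finrank k V = 2) {N : V →ₗ[k] W}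
    (hN : N ≠ 0) (hker : N.ker ≠ ⊥) :
    ∃ v ≠ 0, ∀ (X : Module.End k V) (Y : Module.End k W), N ∘ₗ X = Y ∘ₗ N →
      ∃ a : k, X v = a • v := by
  have : FiniteDimensional k V := Module.finite_of_finrank_eq_succ hV
  have ker_lt : Module.finrank k N.ker < 2 := hV ▸ Submodule.finrank_lt
    fun h => hN (LinearMap.ker_eq_top.1 h)
  have ker_pos : 0 < Module.finrank k N.ker := by
    rwa [Nat.pos_iff_ne_zero, ne_eq, Submodule.finrank_eq_zero]
  obtain ⟨v, hv, span_v⟩ := finrank_eq_one_iff'.1 (by omega : Module.finrank k N.ker = 1)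
  refine ⟨v, by simpa using hv, fun X Y hXY => ?_⟩
  have : X v ∈ N.ker := by
    rw [LinearMap.mem_ker, ← LinearMap.comp_apply, hXY, LinearMap.comp_apply, v.2, map_zero]
  obtain ⟨a, ha⟩ := span_v ⟨X v, this⟩
  exact ⟨a, (congrArg Subtype.val ha).symm⟩

theorem exists_primitive_smul {O K ι : Type*} [CommRing O] [IsDomain O] [ValuationRing O] [Field K]
    [Algebra O K] [IsFractionRing O K] [Finite ι] {f : ι → K} (hf : f ≠ 0) :
    ∃ (c : K) (g : ι → O), (∀ i, algebraMap O K (g i) = c * f i) ∧ ∃ i, g i = 1 := by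
  obtain ⟨i₀, hi₀⟩ := Function.ne_iff.1 hf
  have : Nonempty ι := ⟨i₀⟩
  let v := ValuationRing.valuation O K
  obtain ⟨i, hi⟩ := Finite.exists_max fun j => v (f j)
  have hfi : f i ≠ 0 := fun h0 => hi₀ (v.zero_iff.1 (le_zero_iff.1 (by simpa [h0] using hi i₀)))
  have mem (j) : ∃ a : O, algebraMap O K a = (f i)⁻¹ * f j := by
    refine (ValuationRing.mem_integer_iff O K _).1 ?_
    rw [Valuation.mem_integer_iff, map_mul, map_inv₀,
      inv_mul_le_iff₀ (by simpa [zero_lt_iff] using hfi), mul_one]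
    exact hi j
  choose g hg using mem
  refine ⟨(f i)⁻¹, g, hg, i, IsFractionRing.injective O K ?_⟩
  rw [hg, inv_mul_cancel₀ hfi, map_one]

theorem DicyclicPair.isUnit_det_of_primitive_intertwiner {O : Type*} [CommRing O] [IsLocalRing O]
    {R P R' P' N : Matrix (Fin 2) (Fin 2) O} (h : DicyclicPair R P) (hR : N * R = R' * N)
    (hP : N * P = P' * N) (hN : ∃ i j, N i j = 1)
    (hk : ∀ a b : IsLocalRing.ResidueField O, ¬ DicyclicPair a b) : IsUnit N.det := by
  by_contra not_unit
  let k := IsLocalRing.ResidueField O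
  let π : Matrix (Fin 2) (Fin 2) O →+* Module.End k (Fin 2 → k) :=
    Matrix.toLinAlgEquiv'.toRingHom.comp (IsLocalRing.residue O).mapMatrix
  have intertwines {X Y : Matrix (Fin 2) (Fin 2) O} (hXY : N * X = Y * N) :
      π N ∘ₗ π X = π Y ∘ₗ π N :=
    (map_mul π N X).symm.trans ((congrArg π hXY).trans (map_mul π Y N))
  have π_N_ne_zero : π N ≠ 0 := by
    obtain ⟨i, j, hij⟩ := hN
    intro h0
    have : (IsLocalRing.residue O).mapMatrix N = 0 :=
      Matrix.toLinAlgEquiv'.injective (h0.trans (map_zero _).symm)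
    simpa [hij] using congr($this i j)
  have ker_ne_bot : (π N).ker ≠ ⊥ := by
    refine (LinearMap.bot_lt_ker_of_det_eq_zero ?_).ne'
    have : LinearMap.det (π N) = _ := LinearMap.det_toLin' ((IsLocalRing.residue O).mapMatrix N)
    rw [this, ← RingHom.map_det, IsLocalRing.residue_eq_zero_iff]
    exact not_unit
  obtain ⟨v, hv, eigen⟩ := exists_common_eigenvector (by simp) π_N_ne_zero ker_ne_bot
  obtain ⟨a, ha⟩ := eigen _ _ (intertwines hR)
  obtain ⟨b, hb⟩ := eigen _ _ (intertwines hP)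
  exact hk a b ((h.map π).of_eigenvector hv ha hb)

section Uniqueness

variable {F : Type*} [Field F] {O : Subring F} [ValuationRing O] [IsFractionRing O F]

theorem IntegralRep.exists_primitive_intertwiner {G : Type*} [Group G] {n : ℕ}
    {ρ : G →* GL (Fin n) F} [Nonempty (Fin n)] (σ τ : IntegralRep O ρ) :
    ∃ N : Matrix (Fin n) (Fin n) O,
      (∀ x, N * (σ.1 x).1 = (τ.1 x).1 * N) ∧ ∃ i j, N i j = 1 := by
  obtain ⟨g, hg⟩ := σ.exists_intertwiner τ
  have g_ne : (fun ij : Fin n × Fin n => g.1 ij.1 ij.2) ≠ 0 := fun h =>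
    g.ne_zero (Matrix.ext fun i j => congr_fun h (i, j))
  obtain ⟨c, N, hN, ij, hij⟩ := exists_primitive_smul (O := O) g_ne
  have hN' : O.subtype.mapMatrix (.of fun i j => N (i, j)) = c • g.1 :=
    Matrix.ext fun i j => hN (i, j)
  refine ⟨.of fun i j => N (i, j), fun x => ?_, ij.1, ij.2, hij⟩
  refine Matrix.map_injective (f := O.subtype) Subtype.val_injective ?_
  have hg' : g.1 * O.subtype.mapMatrix (σ.1 x).1 = O.subtype.mapMatrix (τ.1 x).1 * g.1 :=
    congrArg Units.val (hg x)
  change O.subtype.mapMatrix _ = O.subtype.mapMatrix _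
  rw [map_mul, map_mul, hN', smul_mul_assoc, mul_smul_comm, hg']

theorem card_integralForms_eq_one {ρ : dicyclicGroup →* GL (Fin 2) F}
    (hρ : DicyclicPair (ρ dicyclicGroup.r).1 (ρ dicyclicGroup.p).1)
    (hk : ∀ a b : IsLocalRing.ResidueField O, ¬ DicyclicPair a b) :
    ENat.card (IntegralForms O ρ) = 1 := by
  obtain ⟨σ⟩ := IntegralRep.nonempty_of_finite (O := O) ρ
  refine ENat.card_eq_one_iff_unique.2 ((unique_iff_subsingleton_and_nonempty _).2
    ⟨⟨fun x y => ?_⟩, ⟨Quotient.mk _ σ⟩⟩)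
  induction x, y using Quotient.inductionOn₂ with
  | h σ τ =>
    obtain ⟨N, hN, primitive⟩ := σ.exists_primitive_intertwiner τ
    have unit_det := (σ.dicyclicPair_generators hρ).isUnit_det_of_primitive_intertwiner
      (hN _) (hN _) primitive hk
    obtain ⟨h, rfl⟩ := (Matrix.isUnit_iff_isUnit_det N).2 unit_det
    exact Quotient.sound (IntegralRep.setoid_iff_isConjPair_generators.2 ⟨h, hN _, hN _⟩)

end Uniqueness

section SplitPair

variable {A : Type*} [CommRing A]

/-- The pair of matrices over a ring with `h = 1 / 2` and `s = √-1` in which `p` is diagonal. It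
satisfies the dicyclic relations when `β * γ = -3`. -/
def splitPair (h s β γ : A) : Matrix (Fin 2) (Fin 2) A × Matrix (Fin 2) (Fin 2) A :=
  (!![h, h * β; h * γ, h], !![s, 0; 0, -s])

variable {h s β γ β' γ' : A}

theorem map_splitPair {B : Type*} [CommRing B] (f : A →+* B) :
    (splitPair h s β γ).map f.mapMatrix f.mapMatrix = splitPair (f h) (f s) (f β) (f γ) := by
  ext i j <;> fin_cases i <;> fin_cases j <;> simp [splitPair]

theorem exists_eq_splitPair (hh : 2 * h = 1) (hs : s ^ 2 = -1) {R : Matrix (Fin 2) (Fin 2) A}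
    (H : DicyclicPair R !![s, 0; 0, -s]) :
    ∃ β γ, β * γ = -3 ∧ splitPair h s β γ = (R, !![s, 0; 0, -s]) := by
  have p_mul_r₀ := congr($H.p_mul_r 0 0)
  have p_mul_r₁ := congr($H.p_mul_r 1 1)
  have r_mul_r := congr($H.r_mul_r 0 0)
  simp only [Matrix.mul_apply, Matrix.sub_apply, Fin.sum_univ_two, Matrix.of_apply,
    Matrix.cons_val', Matrix.cons_val_zero, Matrix.cons_val_one, Matrix.cons_val_fin_one,
    Matrix.one_apply_eq] at p_mul_r₀ p_mul_r₁ r_mul_r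
  have R₀₀ : R 0 0 = h := by
    linear_combination (-R 0 0) * hh - h * s * p_mul_r₀ + h * (2 * R 0 0 - 1) * hs
  have R₁₁ : R 1 1 = h := by
    linear_combination (-R 1 1) * hh + h * s * p_mul_r₁ + h * (2 * R 1 1 - 1) * hs
  refine ⟨2 * R 0 1, 2 * R 1 0, ?_, Prod.ext ?_ rfl⟩
  · rw [R₀₀] at r_mul_r
    linear_combination 4 * r_mul_r - (2 * h - 1) * hh
  · ext i j
    fin_cases i <;> fin_cases j <;> simp [splitPair, R₀₀, R₁₁] <;> linear_combination R _ _ * hh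

theorem DicyclicPair.trace_p_eq_zero [IsDomain A] (h3 : (3 : A) ≠ 0)
    {R P : Matrix (Fin 2) (Fin 2) A} (H : DicyclicPair R P) : P.trace = 0 := by
  have r_mul_p_mul_r : R * (P * R) = P := by
    rw [H.p_mul_r, ← mul_assoc, H.r_mul_one_sub_r, one_mul]
  have trace_eq : P.trace = (R * P).trace - P.trace := by
    have := congrArg Matrix.trace r_mul_p_mul_r
    rwa [Matrix.trace_mul_comm, mul_assoc, H.r_mul_r, mul_sub, mul_one, Matrix.trace_sub,
      Matrix.trace_mul_comm, eq_comm] at this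
  have trace_eq' := congrArg Matrix.trace H.p_mul_r
  rw [sub_mul, one_mul, Matrix.trace_sub, Matrix.trace_mul_comm P] at trace_eq'
  have three_mul_trace : 3 * P.trace = 0 := by linear_combination 2 * trace_eq + trace_eq'
  exact (mul_eq_zero.1 three_mul_trace).resolve_left h3

theorem exists_semiconjBy_diagonal [IsLocalRing A] (hh : 2 * h = 1) (hs : s ^ 2 = -1)
    {P : Matrix (Fin 2) (Fin 2) A} (trace_P : P.trace = 0) (hP : P * P = -1) :
    ∃ g : GL (Fin 2) A, SemiconjBy g.1 !![s, 0; 0, -s] P := by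
  obtain ⟨a, b, c, rfl⟩ : ∃ a b c, P = !![a, b; c, -a] := by
    rw [Matrix.trace_fin_two] at trace_P
    refine ⟨P 0 0, P 0 1, P 1 0, ?_⟩
    rw [← eq_neg_of_add_eq_zero_right trace_P]
    exact Matrix.eta_fin_two P
  have habc : a ^ 2 + b * c = -1 := by simpa [pow_two] using congr($hP 0 0)
  suffices ∃ S : Matrix (Fin 2) (Fin 2) A, IsUnit S.det ∧
      SemiconjBy S !![s, 0; 0, -s] !![a, b; c, -a] by
    obtain ⟨S, unit_det, hS⟩ := this
    obtain ⟨g, rfl⟩ := (Matrix.isUnit_iff_isUnit_det S).2 unit_det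
    exact ⟨g, hS⟩
  have unit_two : IsUnit (2 : A) := .of_mul_eq_one h hh
  have unit_add : IsUnit (s * (a + s) + s * (s - a)) := by
    rw [show s * (a + s) + s * (s - a) = -2 by linear_combination 2 * hs]
    exact unit_two.neg
  -- The columns of `P + s` are eigenvectors of `P` for `s`, those of `P - s` for `-s`.
  rcases IsLocalRing.isUnit_or_isUnit_of_isUnit_add unit_add with unit | unit
  · refine ⟨!![a + s, b; c, -(a + s)], ?_, ?_⟩
    · rw [Matrix.det_fin_two_of, show (a + s) * -(a + s) - b * c = -2 * (s * (a + s)) by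
        linear_combination hs - habc]
      exact unit_two.neg.mul unit
    · ext i j
      fin_cases i <;> fin_cases j <;> simp <;> grind
  · refine ⟨!![b, a - s; s - a, c], ?_, ?_⟩
    · rw [Matrix.det_fin_two_of, show b * c - (a - s) * (s - a) = 2 * (s * (s - a)) by
        linear_combination habc - hs]
      exact unit_two.mul unit
    · ext i j
      fin_cases i <;> fin_cases j <;> simp <;> grind

theorem DicyclicPair.exists_isConjPair_splitPair [IsDomain A] [IsLocalRing A] (h3 : (3 : A) ≠ 0)
    (hh : 2 * h = 1) (hs : s ^ 2 = -1) {R P : Matrix (Fin 2) (Fin 2) A} (H : DicyclicPair R P) :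
    ∃ β γ, β * γ = -3 ∧ IsConjPair (splitPair h s β γ) (R, P) := by
  obtain ⟨g, hg⟩ := exists_semiconjBy_diagonal hh hs (H.trace_p_eq_zero h3) H.p_mul_p
  have conj_P : (g⁻¹).1 * P * (g⁻¹⁻¹).1 = !![s, 0; 0, -s] := by
    rw [inv_inv, mul_assoc, ← hg.eq, Units.inv_mul_cancel_left]
  obtain ⟨β, γ, hβγ, hsplit⟩ := exists_eq_splitPair hh hs (conj_P ▸ H.conj g⁻¹)
  refine ⟨β, γ, hβγ, hsplit ▸ ⟨g, ?_, hg⟩⟩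
  rw [SemiconjBy, inv_inv, mul_assoc, Units.mul_inv_cancel_left]

/-- The matrices commuting with `p = diag(s, -s)` are diagonal, so conjugation can only multiply
`β` by a unit. -/
theorem isConjPair_splitPair_iff [IsDomain A] (h3 : (3 : A) ≠ 0) (hh : 2 * h = 1)
    (hs : s ^ 2 = -1) (hβγ : β * γ = -3) (hβγ' : β' * γ' = -3) :
    IsConjPair (splitPair h s β γ) (splitPair h s β' γ') ↔ Associated β β' := by
  constructor
  · rintro ⟨g, hR, hP⟩
    have unit_det := (Matrix.isUnit_iff_isUnit_det g.1).1 g.isUnit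
    have hR₀₁ := congr($hR 0 1)
    have hP₀₁ := congr($hP 0 1)
    have hP₁₀ := congr($hP 1 0)
    simp only [splitPair, Matrix.mul_apply, Fin.sum_univ_two, Matrix.of_apply, Matrix.cons_val',
      Matrix.cons_val_zero, Matrix.cons_val_one, Matrix.cons_val_fin_one] at hR₀₁ hP₀₁ hP₁₀
    have g₀₁ : g.1 0 1 = 0 := by
      linear_combination (h * s) * hP₀₁ - g.1 0 1 * hh + 2 * h * g.1 0 1 * hs
    have g₁₀ : g.1 1 0 = 0 := by
      linear_combination -(h * s) * hP₁₀ - g.1 1 0 * hh + 2 * h * g.1 1 0 * hs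
    rw [Matrix.det_fin_two, g₀₁, zero_mul, sub_zero] at unit_det
    obtain ⟨u, hu⟩ := isUnit_of_mul_isUnit_left unit_det
    obtain ⟨v, hv⟩ := isUnit_of_mul_isUnit_right unit_det
    rw [g₀₁, ← hu, ← hv] at hR₀₁
    refine ⟨u * v⁻¹, ?_⟩
    have : β * u = β' * v := by linear_combination 2 * hR₀₁ + (β' * v - β * u) * hh
    rw [Units.val_mul, ← mul_assoc, this, Units.mul_inv_cancel_right]
  · rintro ⟨u, rfl⟩
    have β_ne_zero : β ≠ 0 := left_ne_zero_of_mul (hβγ.trans_ne (neg_ne_zero.2 h3))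
    have hγ : γ' * u = γ := mul_left_cancel₀ β_ne_zero (by linear_combination hβγ' - hβγ)
    refine ⟨⟨!![(u : A), 0; 0, 1], !![(↑u⁻¹ : A), 0; 0, 1], ?_, ?_⟩, ?_, ?_⟩ <;> ext i j <;>
      fin_cases i <;> fin_cases j <;> simp [splitPair, ← hγ] <;> ring

end SplitPair

section Count

variable {F : Type*} [Field F] {O : Subring F} {ρ : dicyclicGroup →* GL (Fin 2) F}

theorem IntegralRep.exists_generators_eq_of_isConjPair {n : ℕ}
    {ρ : dicyclicGroup →* GL (Fin n) F} {x : Matrix (Fin n) (Fin n) O × Matrix (Fin n) (Fin n) O}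
    (hx : IsConjPair ((ρ dicyclicGroup.r).1, (ρ dicyclicGroup.p).1)
      (x.map O.subtype.mapMatrix O.subtype.mapMatrix)) :
    ∃ σ : IntegralRep O ρ, σ.generators = x := by
  obtain ⟨g, hr, hp⟩ := hx
  have conj_r : (g * ρ dicyclicGroup.r * g⁻¹).1 = O.subtype.mapMatrix x.1 :=
    (Units.mul_inv_eq_iff_eq_mul g).2 hr
  have conj_p : (g * ρ dicyclicGroup.p * g⁻¹).1 = O.subtype.mapMatrix x.2 :=
    (Units.mul_inv_eq_iff_eq_mul g).2 hp
  let conjRep : dicyclicGroup →* Matrix (Fin n) (Fin n) F :=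
    (Units.coeHom _).comp ((MulAut.conj g).toMonoidHom.comp ρ)
  have integral : ⊤ ≤ O.matrix.toSubmonoid.comap conjRep := by
    rw [← dicyclicGroup.submonoid_closure_r_p, Submonoid.closure_le]
    rintro _ (rfl | rfl) i j
    · exact (congrArg (· ∈ O) congr($conj_r i j)).mpr (x.1 i j).2
    · exact (congrArg (· ∈ O) congr($conj_p i j)).mpr (x.2 i j).2
  obtain ⟨σ, hσ⟩ := IntegralRep.exists_of_mem_matrix g fun y => integral (Submonoid.mem_top y)
  have injective : Function.Injective (O.subtype.mapMatrix (m := Fin n)) :=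
    Matrix.map_injective Subtype.val_injective
  exact ⟨σ, Prod.ext (injective ((congrArg Units.val (hσ _)).trans conj_r))
    (injective ((congrArg Units.val (hσ _)).trans conj_p))⟩

theorem IntegralRep.exists_generators_eq_splitPair (h3 : (3 : F) ≠ 0)
    (hρ : DicyclicPair (ρ dicyclicGroup.r).1 (ρ dicyclicGroup.p).1) {h s β γ : O}
    (hh : 2 * h = 1) (hs : s ^ 2 = -1) (hβγ : β * γ = -3) :
    ∃ σ : IntegralRep O ρ, σ.generators = splitPair h s β γ := by
  refine IntegralRep.exists_generators_eq_of_isConjPair ?_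
  rw [map_splitPair]
  have hh' : 2 * O.subtype h = 1 := by
    simpa only [map_mul, map_ofNat, map_one] using congrArg O.subtype hh
  have hs' : O.subtype s ^ 2 = -1 := by
    simpa only [map_pow, map_neg, map_one] using congrArg O.subtype hs
  have hβγ' : O.subtype β * O.subtype γ = -3 := by
    simpa only [map_mul, map_neg, map_ofNat] using congrArg O.subtype hβγ
  have unit {x y : F} (hxy : x * y = -3) : IsUnit x :=
    .mk0 x (left_ne_zero_of_mul (hxy.trans_ne (neg_ne_zero.2 h3)))
  obtain ⟨β₀, γ₀, hβγ₀, conj⟩ := hρ.exists_isConjPair_splitPair h3 hh' hs'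
  exact conj.symm.trans ((isConjPair_splitPair_iff h3 hh' hs' hβγ₀ hβγ').2
    (associated_of_dvd_dvd (unit hβγ₀).dvd (unit hβγ').dvd))

theorem card_integralForms_eq_card_divisors [IsLocalRing O] (h3 : (3 : F) ≠ 0)
    (hρ : DicyclicPair (ρ dicyclicGroup.r).1 (ρ dicyclicGroup.p).1) {h s : O}
    (hh : 2 * h = 1) (hs : s ^ 2 = -1) :
    ENat.card (IntegralForms O ρ) = ENat.card {b : Associates O // b ∣ Associates.mk 3} := by
  have h3' : (3 : O) ≠ 0 := fun h0 =>
    h3 (by simpa only [map_ofNat, map_zero] using congrArg O.subtype h0)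
  have splits (σ : IntegralRep O ρ) :=
    (σ.dicyclicPair_generators hρ).exists_isConjPair_splitPair h3' hh hs
  choose β γ hβγ conj using splits
  have dvd {x y : O} (hxy : x * y = -3) : Associates.mk x ∣ Associates.mk 3 :=
    Associates.mk_dvd_mk.2 (dvd_neg.1 ⟨y, hxy.symm⟩)
  have setoid_iff (σ τ) :
      integralRepSetoid O ρ σ τ ↔ Associates.mk (β σ) = Associates.mk (β τ) := by
    rw [IntegralRep.setoid_iff_isConjPair_generators, Associates.mk_eq_mk_iff_associated,
      ← isConjPair_splitPair_iff h3' hh hs (hβγ σ) (hβγ τ)]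
    exact ⟨fun H => ((conj σ).trans H).trans (conj τ).symm,
      fun H => ((conj σ).symm.trans H).trans (conj τ)⟩
  refine ENat.card_congr (Equiv.ofBijective (Quotient.lift
    (fun σ => ⟨Associates.mk (β σ), dvd (hβγ σ)⟩)
    fun σ τ hστ => Subtype.ext ((setoid_iff σ τ).1 hστ)) ⟨?_, ?_⟩)
  · rintro ⟨σ⟩ ⟨τ⟩ hστ
    exact Quotient.sound ((setoid_iff σ τ).2 (congrArg Subtype.val hστ))
  · rintro ⟨⟨b⟩, hb⟩
    obtain ⟨c, hc⟩ := dvd_neg.2 (Associates.mk_dvd_mk.1 hb)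
    obtain ⟨σ, hσ⟩ := IntegralRep.exists_generators_eq_splitPair h3 hρ hh hs hc.symm
    refine ⟨Quotient.mk _ σ, Subtype.ext (Associates.mk_eq_mk_iff_associated.2 ?_)⟩
    exact (isConjPair_splitPair_iff h3' hh hs (hβγ σ) hc.symm).1 (hσ ▸ conj σ)

end Count

section Divisors

variable {O K : Type*} [CommRing O] [Field K] [Algebra O K] [FaithfulSMul O K]

theorem exists_zpow_mul_eq_not_dvd {ϖ : O} (ϖ_ne_zero : ϖ ≠ 0) (not_unit : ¬ IsUnit ϖ)
    (away : ∀ x : K, ∃ (n : ℕ) (a : O), algebraMap O K ϖ ^ n * x = algebraMap O K a) {x : K}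
    (hx : x ≠ 0) :
    ∃ (n : ℤ) (a : O), algebraMap O K ϖ ^ n * algebraMap O K a = x ∧ ¬ ϖ ∣ a := by
  have : IsDomain O := (FaithfulSMul.algebraMap_injective O K).isDomain
  have ϖ_ne_zero' : algebraMap O K ϖ ≠ 0 := by simpa using ϖ_ne_zero
  obtain ⟨n, a, ha⟩ := away x
  have a_ne_zero : algebraMap O K a ≠ 0 := ha ▸ mul_ne_zero (pow_ne_zero n ϖ_ne_zero') hx
  obtain ⟨m, b, hb⟩ := away (algebraMap O K a)⁻¹
  have dvd_pow : a ∣ ϖ ^ m := ⟨b, FaithfulSMul.algebraMap_injective O K <| by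
    rw [map_mul, ← hb, map_pow, mul_left_comm, mul_inv_cancel₀ a_ne_zero, mul_one]⟩
  have finite : FiniteMultiplicity ϖ a := ⟨m, fun h => not_unit <| by
    obtain ⟨c, hc⟩ := h.trans dvd_pow
    refine .of_mul_eq_one c (mul_left_cancel₀ (pow_ne_zero m ϖ_ne_zero) ?_)
    rw [← mul_assoc, ← pow_succ, ← hc, mul_one]⟩
  obtain ⟨c, hc, not_dvd⟩ := finite.exists_eq_pow_mul_and_not_dvd
  refine ⟨multiplicity ϖ a - n, c, ?_, not_dvd⟩
  rw [zpow_sub₀ ϖ_ne_zero', zpow_natCast, zpow_natCast, div_mul_eq_mul_div, ← map_pow, ← map_mul,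
    ← hc, ← ha, mul_div_cancel_left₀ _ (pow_ne_zero n ϖ_ne_zero')]

theorem associated_of_not_dvd {ϖ a b : O} (ϖ_ne_zero : ϖ ≠ 0) (ha : ¬ ϖ ∣ a) (hb : ¬ ϖ ∣ b)
    (u : Oˣ) (n : ℤ) (h : algebraMap O K b = algebraMap O K (a * u) * algebraMap O K ϖ ^ n) :
    Associated a b := by
  have injective := FaithfulSMul.algebraMap_injective O K
  obtain ⟨n, rfl | rfl⟩ := n.eq_nat_or_neg
  · rw [zpow_natCast, ← map_pow, ← map_mul] at h
    rcases n with _ | n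
    · exact ⟨u, by simpa using (injective h).symm⟩
    · exact absurd ⟨a * u * ϖ ^ n, by rw [injective h, pow_succ]; ring⟩ hb
  · have ϖ_pow_ne_zero : algebraMap O K ϖ ^ n ≠ 0 := pow_ne_zero n (by simpa using ϖ_ne_zero)
    rw [zpow_neg, zpow_natCast, eq_mul_inv_iff_mul_eq₀ ϖ_pow_ne_zero, ← map_pow, ← map_mul] at h
    rcases n with _ | n
    · exact ⟨u, by simpa using (injective h).symm⟩
    · refine absurd (u.isUnit.dvd_mul_right.1 ⟨b * ϖ ^ n, ?_⟩) ha
      rw [← injective h, pow_succ]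
      ring

/-- Every nonzero element of `K` is a power of `ϖ` times an element of `O` not divisible by `ϖ`, and
the latter is unique up to units of `O`. -/
theorem card_not_dvd_eq_card_quotient {ϖ : O} {ϖ' : Kˣ} (hϖ : algebraMap O K ϖ = ϖ')
    (not_unit : ¬ IsUnit ϖ)
    (away : ∀ x : K, ∃ (n : ℕ) (a : O), algebraMap O K ϖ ^ n * x = algebraMap O K a) :
    ENat.card {b : Associates O // ¬ Associates.mk ϖ ∣ b} = ENat.card (Kˣ ⧸
      ((Units.map (algebraMap O K).toMonoidHom).range ⊔ Subgroup.zpowers ϖ')) := by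
  have ϖ_ne_zero : ϖ ≠ 0 := by
    rintro rfl
    exact ϖ'.ne_zero (by rw [← hϖ, map_zero])
  have out_not_dvd (b : {b // ¬ Associates.mk ϖ ∣ b}) : ¬ ϖ ∣ Quot.out b.1 := by
    rw [← Associates.mk_dvd_mk, Associates.quot_out]
    exact b.2
  let toUnit (b : {b // ¬ Associates.mk ϖ ∣ b}) : Kˣ :=
    Units.mk0 (algebraMap O K (Quot.out b.1)) fun h0 => out_not_dvd b <| by
      rw [(map_eq_zero_iff _ (FaithfulSMul.algebraMap_injective O K)).1 h0]
      exact dvd_zero ϖ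
  refine ENat.card_congr (Equiv.ofBijective (fun b => QuotientGroup.mk (toUnit b)) ⟨?_, ?_⟩)
  · intro b c hbc
    obtain ⟨_, ⟨u, rfl⟩, _, ⟨n, rfl⟩, h⟩ := Subgroup.mem_sup.1 (QuotientGroup.eq.1 hbc)
    have := associated_of_not_dvd (K := K) ϖ_ne_zero (out_not_dvd b) (out_not_dvd c) u n <| by
      rw [map_mul, hϖ, mul_assoc, ← Units.val_zpow_eq_zpow_val]
      exact congrArg Units.val (eq_inv_mul_iff_mul_eq.1 h).symm
    rw [← Associates.mk_eq_mk_iff_associated, Associates.quot_out, Associates.quot_out] at this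
    exact Subtype.ext this
  · intro x
    obtain ⟨x, rfl⟩ := QuotientGroup.mk_surjective x
    obtain ⟨n, a, ha, not_dvd⟩ := exists_zpow_mul_eq_not_dvd ϖ_ne_zero not_unit away x.ne_zero
    refine ⟨⟨Associates.mk a, by rwa [Associates.mk_dvd_mk]⟩, QuotientGroup.eq.2 ?_⟩
    obtain ⟨u, hu⟩ := Associates.mk_eq_mk_iff_associated.1 (Associates.quot_out (Associates.mk a))
    have hx : (x : K) = algebraMap O K (Quot.out (Associates.mk a)) *
        (algebraMap O K u * (ϖ' ^ n : Kˣ)) := by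
      rw [← mul_assoc, ← map_mul, hu, mul_comm, ← ha, hϖ, Units.val_zpow_eq_zpow_val]
    exact Subgroup.mem_sup.2
      ⟨_, ⟨u, rfl⟩, _, ⟨n, rfl⟩, eq_inv_mul_iff_mul_eq.2 (Units.ext hx.symm)⟩

theorem card_divisors_eq_card_not_dvd_add_one {O : Type*} [CommRing O] [IsDomain O]
    [ValuationRing O] (a : O) :
    ENat.card {b : Associates O // b ∣ Associates.mk a} =
      ENat.card {b : Associates O // ¬ Associates.mk a ∣ b} + 1 := by
  have divisors_eq : {b | b ∣ Associates.mk a} =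
      insert (Associates.mk a) {b | ¬ Associates.mk a ∣ b} := by
    ext b
    obtain ⟨b, rfl⟩ := Associates.mk_surjective b
    simp only [Set.mem_ofPred_eq, Set.mem_insert_iff, Associates.mk_dvd_mk,
      Associates.mk_eq_mk_iff_associated]
    refine ⟨fun h => ?_, ?_⟩
    · exact or_iff_not_imp_right.2 fun h' => associated_of_dvd_dvd h (not_not.1 h')
    · rintro (h | h)
      exacts [h.dvd, (ValuationRing.dvd_total _ _).resolve_left h]
  rw [← Set.coe_ofPred, ENat.card_coe_set_eq, divisors_eq, Set.encard_insert_of_notMem (by simp),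
    ← ENat.card_coe_set_eq]
  rfl

end Divisors

section SquareRoots

open Polynomial

/- If `a` had no square root in `E`, its two square roots `±j` would be conjugate over `E`, hence
equidistant from `x`, and one of the factors of `x ^ 2 - a = (x - j) * (x + j)` would be at least
as large as the difference `2 * j` of the two. -/
theorem exists_sq_eq_of_spectralNorm_sub_lt {K E : Type*} [NontriviallyNormedField K]
    [CompleteSpace K] [IsUltrametricDist K] [Field E] [Algebra K E] [Algebra.IsAlgebraic K E]
    {x a : E} (h : spectralNorm K E (x ^ 2 - a) < spectralNorm K E (4 * a)) :
    ∃ s : E, s ^ 2 = a := by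
  by_contra! ha
  have : Algebra.IsAlgebraic K (AlgebraicClosure E) := .trans K E _
  let v := spectralMulAlgNorm K (AlgebraicClosure E)
  have v_algebraMap (z : E) : v (algebraMap E _ z) = spectralNorm K E z :=
    (spectralNorm.eq_of_tower z).symm
  obtain ⟨j, hj⟩ := IsAlgClosed.exists_pow_nat_eq (algebraMap E (AlgebraicClosure E) a) two_pos
  have minpoly_eq (i : AlgebraicClosure E) (hi : i ^ 2 = algebraMap E _ a) :
      minpoly E i = X ^ 2 - C a :=
    (minpoly.eq_of_irreducible_of_monic (X_pow_sub_C_irreducible_of_prime Nat.prime_two ha)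
      (by simp [hi]) (monic_X_pow_sub_C a two_ne_zero)).symm
  obtain ⟨σ, hσ⟩ := (isConjRoot_iff_exists_algEquiv (K := E) (x := j) (y := -j)).1
    ((minpoly_eq j hj).trans (minpoly_eq (-j) (by rw [neg_sq, hj])).symm)
  set y := algebraMap E (AlgebraicClosure E) x
  have conj_eq : v (j + y) = v (j - y) := by
    calc v (j + y) = v (-j - y) := by rw [← map_neg_eq_map, neg_add']
      _ = v (σ (-j - y)) := spectralNorm_eq_of_equiv (σ.restrictScalars K) _
      _ = v (j - y) := by rw [map_sub, hσ, σ.commutes]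
  have two_mul_le : v (2 * j) ≤ v (j - y) := by
    calc v (2 * j) = v ((j - y) + (j + y)) := by ring_nf
      _ ≤ max (v (j - y)) (v (j + y)) := isNonarchimedean_spectralNorm _ _
      _ = v (j - y) := by rw [conj_eq, max_self]
  refine h.not_ge ?_
  calc spectralNorm K E (4 * a) = v (2 * j) ^ 2 := by
        rw [← v_algebraMap, ← map_pow, mul_pow, hj, map_mul, map_ofNat]; norm_num
    _ ≤ v (j - y) ^ 2 := by gcongr
    _ = v (y - j) * v (j + y) := by rw [conj_eq, map_sub_rev, sq]
    _ = v (y ^ 2 - j ^ 2) := by rw [← map_mul]; ring_nf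
    _ = spectralNorm K E (x ^ 2 - a) := by rw [hj, ← map_pow, ← map_sub, v_algebraMap]

end SquareRoots

theorem exists_eq_unit_mul_zpow {p : ℕ} [Fact p.Prime] {d : ℚ_[p]} (hd : d ≠ 0) :
    ∃ (u : ℤ_[p]ˣ) (n : ℤ), d = u * (p : ℚ_[p]) ^ n := by
  have p_ne_zero : (p : ℚ_[p]) ≠ 0 := mod_cast (Fact.out : p.Prime).ne_zero
  have norm_eq : ‖d * (p : ℚ_[p]) ^ (-d.valuation)‖ = 1 := by
    rw [norm_mul, Padic.norm_eq_zpow_neg_valuation hd, Padic.norm_p_zpow, neg_neg,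
      ← zpow_add₀ (mod_cast (Fact.out : p.Prime).ne_zero), neg_add_cancel, zpow_zero]
  refine ⟨PadicInt.mkUnits norm_eq, d.valuation, ?_⟩
  rw [PadicInt.mkUnits_eq, mul_assoc, zpow_neg, inv_mul_cancel₀ (zpow_ne_zero _ p_ne_zero), mul_one]

namespace localIntegers

variable {p : ℕ} [Fact p.Prime] {E : Type*} [Field E] [Algebra ℚ_[p] E]

theorem mem_of_sq_mem {x : E} (h : x ^ 2 ∈ localIntegers p E) : x ∈ localIntegers p E := by
  let : Algebra ℤ_[p] E := ((algebraMap ℚ_[p] E).comp (algebraMap ℤ_[p] ℚ_[p])).toAlgebra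
  exact IsIntegral.of_pow (R := ℤ_[p]) two_pos h

variable [Algebra.IsAlgebraic ℚ_[p] E]

theorem mem_iff {x : E} : x ∈ localIntegers p E ↔ spectralNorm ℚ_[p] E x ≤ 1 := by
  let : Algebra ℤ_[p] E := ((algebraMap ℚ_[p] E).comp (algebraMap ℤ_[p] ℚ_[p])).toAlgebra
  have : IsScalarTower ℤ_[p] ℚ_[p] E := .of_algebraMap_eq fun _ => rfl
  have integral : IsIntegral ℚ_[p] x := Algebra.IsIntegral.isIntegral x
  change IsIntegral ℤ_[p] x ↔ _
  rw [spectralNorm, spectralValue_le_one_iff (minpoly.monic integral)]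
  constructor
  · intro h n
    rw [minpoly.isIntegrallyClosed_eq_field_fractions' ℚ_[p] h, Polynomial.coeff_map]
    exact PadicInt.norm_le_one _
  · intro h
    have lifts : minpoly ℚ_[p] x ∈ Polynomial.lifts (algebraMap ℤ_[p] ℚ_[p]) :=
      (Polynomial.lifts_iff_coeff_lifts _).2 fun n => ⟨⟨_, h n⟩, rfl⟩
    obtain ⟨q, q_map, -, q_monic⟩ :=
      Polynomial.lifts_and_natDegree_eq_and_monic lifts (minpoly.monic integral)
    refine ⟨q, q_monic, ?_⟩
    rw [← Polynomial.aeval_def, ← Polynomial.aeval_map_algebraMap ℚ_[p], q_map, minpoly.aeval]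

variable (p) in
theorem mem_or_inv_mem (x : E) : x ∈ localIntegers p E ∨ x⁻¹ ∈ localIntegers p E := by
  let := spectralNorm.normedField ℚ_[p] E
  rw [mem_iff, mem_iff, show spectralNorm ℚ_[p] E x⁻¹ = (spectralNorm ℚ_[p] E x)⁻¹ from norm_inv x]
  exact (le_total _ 1).imp_right inv_le_one_of_one_le₀

instance : ValuationRing (localIntegers p E) :=
  inferInstanceAs (ValuationRing (ValuationSubring.ofSubring _ (mem_or_inv_mem p (E := E))))

instance : IsFractionRing (localIntegers p E) E :=
  inferInstanceAs (IsFractionRing (ValuationSubring.ofSubring _ (mem_or_inv_mem p (E := E))) E)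

theorem isUnit_iff {x : localIntegers p E} : IsUnit x ↔ spectralNorm ℚ_[p] E x = 1 := by
  let := spectralNorm.normedField ℚ_[p] E
  have norm_le_one (y : localIntegers p E) : ‖(y : E)‖ ≤ 1 := mem_iff.1 y.2
  change IsUnit x ↔ ‖(x : E)‖ = 1
  constructor
  · rintro ⟨u, rfl⟩
    refine le_antisymm (norm_le_one _) ?_
    calc (1 : ℝ) = ‖((u * u⁻¹ : (localIntegers p E)ˣ) : E)‖ := by simp
      _ = ‖(u : E)‖ * ‖((u⁻¹ : (localIntegers p E)ˣ) : E)‖ := by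
        rw [Units.val_mul, Subring.coe_mul, norm_mul]
      _ ≤ ‖(u : E)‖ := mul_le_of_le_one_right (norm_nonneg _) (norm_le_one _)
  · intro norm_eq
    have ne_zero : (x : E) ≠ 0 := norm_ne_zero_iff.1 (norm_eq.trans_ne one_ne_zero)
    have inv_mem : (x : E)⁻¹ ∈ localIntegers p E :=
      mem_iff.2 (show ‖(x : E)⁻¹‖ ≤ 1 by rw [norm_inv, norm_eq, inv_one])
    exact .of_mul_eq_one ⟨_, inv_mem⟩ (Subtype.ext (mul_inv_cancel₀ ne_zero))

theorem isUnit_natCast_iff {n : ℕ} : IsUnit (n : localIntegers p E) ↔ p.Coprime n := by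
  rw [isUnit_iff, ← Padic.norm_natCast_eq_one_iff, ← spectralNorm_extends (L := E), map_natCast,
    Subring.coe_natCast]

theorem exists_sq_eq_neg_one_of_residueField (hp : p ≠ 2)
    {b : IsLocalRing.ResidueField (localIntegers p E)} (hb : b ^ 2 = -1) :
    ∃ s : E, s ^ 2 = -1 := by
  obtain ⟨x, rfl⟩ := IsLocalRing.residue_surjective b
  have not_unit : ¬IsUnit (x ^ 2 + 1) := by
    rw [← mem_nonunits_iff, ← IsLocalRing.mem_maximalIdeal, ← IsLocalRing.residue_eq_zero_iff,
      map_add, map_pow, hb, map_one, neg_add_cancel]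
  have norm_lt : spectralNorm ℚ_[p] E (x ^ 2 + 1 : localIntegers p E) < 1 :=
    (mem_iff.1 (x ^ 2 + 1).2).lt_of_ne (mt isUnit_iff.2 not_unit)
  have norm_four : spectralNorm ℚ_[p] E (4 * -1) = 1 := by
    have coprime : p.Coprime (2 ^ 2) :=
      ((Nat.coprime_primes Fact.out Nat.prime_two).2 hp).pow_right 2
    rw [show (4 * -1 : E) = algebraMap ℚ_[p] E (-(2 ^ 2 : ℕ)) by
      rw [map_neg, map_natCast]; norm_num, spectralNorm_extends, norm_neg,
      Padic.norm_natCast_eq_one_iff.2 coprime]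
  refine exists_sq_eq_of_spectralNorm_sub_lt (K := ℚ_[p]) (x := (x : E)) ?_
  rw [norm_four, show (x : E) ^ 2 - -1 = (x ^ 2 + 1 : localIntegers p E) by push_cast; ring]
  exact norm_lt

theorem exists_pow_mul_eq_coe (x : E) :
    ∃ (n : ℕ) (a : localIntegers p E), (p : E) ^ n * x = a := by
  let := spectralNorm.normedField ℚ_[p] E
  have norm_p : ‖(p : E)‖ = (p : ℝ)⁻¹ := by
    rw [← Padic.norm_p, ← map_natCast (algebraMap ℚ_[p] E)]
    exact spectralNorm_extends _
  have one_lt : (1 : ℝ) < p := mod_cast (Fact.out : p.Prime).one_lt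
  obtain ⟨n, hn⟩ := pow_unbounded_of_one_lt ‖x‖ one_lt
  refine ⟨n, ⟨(p : E) ^ n * x, mem_iff.2 (?_ : ‖(p : E) ^ n * x‖ ≤ 1)⟩, rfl⟩
  rw [norm_mul, norm_pow, norm_p, inv_pow]
  exact inv_mul_le_one_of_le₀ hn.le (by positivity)

variable (p E) in
theorem range_units_sup_range_algebraMap {ϖ : Eˣ} (hϖ : (ϖ : E) = p) :
    (Units.map (localIntegers p E).subtype.toMonoidHom).range ⊔
        (Units.map (algebraMap ℚ_[p] E).toMonoidHom).range =
      (Units.map (localIntegers p E).subtype.toMonoidHom).range ⊔ Subgroup.zpowers ϖ := by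
  have p_ne_zero : (p : ℚ_[p]) ≠ 0 := mod_cast (Fact.out : p.Prime).ne_zero
  refine le_antisymm (sup_le le_sup_left ?_) (sup_le le_sup_left ?_)
  · rintro _ ⟨d, rfl⟩
    obtain ⟨v, n, hd⟩ := exists_eq_unit_mul_zpow d.ne_zero
    have norm_eq : spectralNorm ℚ_[p] E (algebraMap ℚ_[p] E v) = 1 :=
      (spectralNorm_extends _).trans (PadicInt.norm_units v)
    obtain ⟨u, hu⟩ : IsUnit (⟨_, mem_iff.2 norm_eq.le⟩ : localIntegers p E) := isUnit_iff.2 norm_eq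
    convert Subgroup.mul_mem_sup (MonoidHom.mem_range.2 ⟨u, rfl⟩)
      (Subgroup.zpow_mem_zpowers ϖ n) using 1
    ext
    calc algebraMap ℚ_[p] E d = (u : localIntegers p E) * (ϖ : E) ^ n := by
          rw [hd, hu, hϖ, map_mul, map_zpow₀, map_natCast]
      _ = _ := by rw [Units.val_mul, Units.val_zpow_eq_zpow_val]; rfl
  · rw [Subgroup.zpowers_le]
    exact Subgroup.mem_sup_right ⟨Units.mk0 p p_ne_zero, Units.ext (by simp [hϖ])⟩

variable (p E) in
theorem card_divisors_p : ENat.card {b : Associates (localIntegers p E) // b ∣ Associates.mk ↑p} =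
      localRamificationIndex p E + 1 := by
  have p_ne_zero : (p : E) ≠ 0 := by
    rw [← map_natCast (algebraMap ℚ_[p] E), map_ne_zero, Nat.cast_ne_zero]
    exact (Fact.out : p.Prime).ne_zero
  rw [card_divisors_eq_card_not_dvd_add_one, localRamificationIndex,
    range_units_sup_range_algebraMap p E (Units.val_mk0 p_ne_zero)]
  congr 1
  refine card_not_dvd_eq_card_quotient rfl ?_ exists_pow_mul_eq_coe
  rw [isUnit_natCast_iff, Nat.coprime_self]
  exact (Fact.out : p.Prime).one_lt.ne'

end localIntegers

section PadicSquares

variable {p : ℕ} [Fact p.Prime]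

theorem exists_sq_mem_range_algebraMap_of_finrank_eq_two {K F : Type*} [Field K] [Field F]
    [CharZero K] [Algebra K F] (hF : Module.finrank K F = 2) :
    ∃ y : F, y ^ 2 ∈ Set.range (algebraMap K F) ∧ y ∉ Set.range (algebraMap K F) := by
  have : Algebra.IsQuadraticExtension K F := { finrank_eq_two' := hF }
  have : FiniteDimensional K F := .of_finrank_eq_succ hF
  have primitive : (primitiveRoots (Module.finrank K F) K).Nonempty :=
    ⟨-1, (mem_primitiveRoots (by omega)).2 (hF ▸ IsPrimitiveRoot.neg_one 0 two_ne_zero.symm)⟩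
  obtain ⟨y, hy, adjoin_eq⟩ := exists_root_adjoin_eq_top_of_isCyclic K F primitive
  refine ⟨y, hF ▸ hy, fun y_mem => ?_⟩
  have bot_eq : (⊥ : IntermediateField K F) = ⊤ := by
    rwa [← IntermediateField.adjoin_simple_eq_bot_iff.2 (IntermediateField.mem_bot.2 y_mem)]
  have := IntermediateField.bot_eq_top_iff_finrank_eq_one.1 bot_eq
  omega

theorem isSquare_of_norm_sub_lt {x a : ℚ_[p]} (h : ‖x ^ 2 - a‖ < ‖4 * a‖) : IsSquare a := by
  rw [← spectralNorm_extends (L := ℚ_[p]), ← spectralNorm_extends (L := ℚ_[p])] at h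
  obtain ⟨s, hs⟩ := exists_sq_eq_of_spectralNorm_sub_lt h
  exact ⟨s, by rw [← sq, hs]⟩

theorem isSquare_coe_of_isSquare_toZMod (hp : p ≠ 2) {a : ℤ_[p]} (ha : PadicInt.toZMod a ≠ 0)
    (h : IsSquare (PadicInt.toZMod a)) : IsSquare (a : ℚ_[p]) := by
  have norm_lt_one_iff (z : ℤ_[p]) : ‖z‖ < 1 ↔ PadicInt.toZMod z = 0 := by
    rw [← PadicInt.mem_nonunits, ← IsLocalRing.mem_maximalIdeal, ← PadicInt.ker_toZMod,
      RingHom.mem_ker]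
  have coprime : p.Coprime (2 ^ 2) :=
    ((Nat.coprime_primes Fact.out Nat.prime_two).2 hp).pow_right 2
  have norm_four : ‖(4 : ℚ_[p])‖ = 1 := mod_cast Padic.norm_natCast_eq_one_iff.2 coprime
  have norm_a : ‖(a : ℚ_[p])‖ = 1 :=
    (PadicInt.norm_le_one a).antisymm (not_lt.1 (mt (norm_lt_one_iff a).1 ha))
  obtain ⟨b, hb⟩ := h
  obtain ⟨x, rfl⟩ := ZMod.ringHom_surjective PadicInt.toZMod b
  have norm_lt : ‖x ^ 2 - a‖ < 1 :=
    (norm_lt_one_iff _).2 (by rw [map_sub, map_pow, hb, sq, sub_self])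
  refine isSquare_of_norm_sub_lt (x := x) ?_
  rw [norm_mul, norm_four, norm_a, one_mul]
  exact_mod_cast norm_lt

theorem exists_sq_eq_neg_two : ∃ w : ℚ_[3], w ^ 2 = -2 := by
  have toZMod_eq : PadicInt.toZMod (-2 : ℤ_[3]) = 1 := by rw [map_neg, map_ofNat]; rfl
  obtain ⟨w, hw⟩ := isSquare_coe_of_isSquare_toZMod (by decide)
    (toZMod_eq.trans_ne one_ne_zero) (toZMod_eq ▸ .one)
  exact ⟨w, by rw [sq, ← hw, PadicInt.coe_neg]; rfl⟩

theorem isSquare_or_isSquare_neg_of_isUnit {u : ℤ_[3]} (hu : IsUnit u) :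
    IsSquare (u : ℚ_[3]) ∨ IsSquare (-u : ℚ_[3]) := by
  have eq_one_or : ∀ a : ZMod 3, a ≠ 0 → a = 1 ∨ -a = 1 := by decide
  have ne_zero : PadicInt.toZMod u ≠ 0 := (hu.map _).ne_zero
  rcases eq_one_or _ ne_zero with h | h
  · exact .inl (isSquare_coe_of_isSquare_toZMod (by decide) ne_zero (h ▸ .one))
  · rw [← map_neg] at h
    rw [← PadicInt.coe_neg]
    exact .inr (isSquare_coe_of_isSquare_toZMod (by decide) (h ▸ one_ne_zero) (h ▸ .one))

theorem isSquare_or_of_padic_three {d : ℚ_[3]} (hd : d ≠ 0) :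
    IsSquare d ∨ IsSquare (-d) ∨ IsSquare (3 * d) ∨ IsSquare (-3 * d) := by
  obtain ⟨u, n, rfl⟩ := exists_eq_unit_mul_zpow hd
  have three_mul_zpow : (3 : ℚ_[3]) * 3 ^ n = 3 ^ (n + 1) := by
    rw [zpow_add_one₀ three_ne_zero, mul_comm]
  have isSquare_zpow {m : ℤ} (hm : Even m) : IsSquare ((3 : ℚ_[3]) ^ m) := by
    obtain ⟨k, rfl⟩ := hm
    exact ⟨3 ^ k, zpow_add₀ three_ne_zero k k⟩
  push_cast
  rcases Int.even_or_odd n with hn | hn <;>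
    rcases isSquare_or_isSquare_neg_of_isUnit u.isUnit with hu | hu
  · exact .inl (hu.mul (isSquare_zpow hn))
  · refine .inr (.inl ?_)
    simpa using hu.mul (isSquare_zpow hn)
  · refine .inr (.inr (.inl ?_))
    rw [mul_left_comm, three_mul_zpow]
    exact hu.mul (isSquare_zpow hn.add_one)
  · refine .inr (.inr (.inr ?_))
    rw [neg_mul, mul_left_comm, three_mul_zpow, ← neg_mul]
    exact hu.mul (isSquare_zpow hn.add_one)

theorem exists_sq_add_three_mul_sq_eq_neg_one_zmod (hp : p ≠ 2) (hp' : p ≠ 3) :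
    ∃ x y : ZMod p, x ^ 2 + 3 * y ^ 2 = -1 := by
  have three_ne_zero : (3 : ZMod p) ≠ 0 := by
    rw [← Nat.cast_ofNat, Ne, ZMod.natCast_eq_zero_iff,
      Nat.prime_dvd_prime_iff_eq Fact.out Nat.prime_three]
    exact hp'
  obtain ⟨x, y, h⟩ := FiniteField.exists_root_sum_quadratic (R := ZMod p) (f := .X ^ 2)
    (g := .C 3 * .X ^ 2 + .C 0 * .X + .C 1) (Polynomial.degree_X_pow 2)
    (Polynomial.degree_quadratic three_ne_zero)
    (by rw [ZMod.card]; exact Nat.odd_iff.1 ((Fact.out : p.Prime).odd_of_ne_two hp))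
  refine ⟨x, y, ?_⟩
  simp only [Polynomial.eval_pow, Polynomial.eval_X, Polynomial.eval_add, Polynomial.eval_mul,
    Polynomial.eval_C] at h
  linear_combination h

/- For `p = 2`, take `y = 1 / 2`, as `-7` is a square; otherwise a solution modulo `p` lifts in
whichever of its coordinates is not zero. -/
theorem exists_sq_add_three_mul_sq_eq_neg_one (hp : p ≠ 3) :
    ∃ x y : ℚ_[p], x ^ 2 + 3 * y ^ 2 = -1 := by
  rcases eq_or_ne p 2 with rfl | hp₂
  · have norm_eight : ‖(1 : ℚ_[2]) ^ 2 - -7‖ = 8⁻¹ := by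
      rw [show (1 : ℚ_[2]) ^ 2 - -7 = (2 : ℕ) ^ 3 by norm_num, Padic.norm_p_pow]
      norm_num
    have norm_neg_twenty_eight : ‖(4 * -7 : ℚ_[2])‖ = 4⁻¹ := by
      have norm_seven : ‖((7 : ℕ) : ℚ_[2])‖ = 1 := Padic.norm_natCast_eq_one_iff.2 (by decide)
      rw [show (4 * -7 : ℚ_[2]) = (2 : ℕ) ^ 2 * -(7 : ℕ) by norm_num, norm_mul, norm_neg,
        norm_seven, Padic.norm_p_pow]
      norm_num
    obtain ⟨w, hw⟩ := isSquare_of_norm_sub_lt (x := (1 : ℚ_[2])) (a := -7)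
      (by rw [norm_eight, norm_neg_twenty_eight]; norm_num)
    exact ⟨w / 2, 1 / 2, by linear_combination -hw / 4⟩
  have coe_three : ((3 : ℤ_[p]) : ℚ_[p]) = 3 := rfl
  obtain ⟨x, y, hxy⟩ := exists_sq_add_three_mul_sq_eq_neg_one_zmod hp₂ hp
  obtain ⟨x, rfl⟩ := ZMod.ringHom_surjective PadicInt.toZMod x
  obtain ⟨y, rfl⟩ := ZMod.ringHom_surjective PadicInt.toZMod y
  by_cases hx : PadicInt.toZMod x = 0
  · have toZMod_eq : PadicInt.toZMod (-3 * (1 + x ^ 2)) = (3 * PadicInt.toZMod y) ^ 2 := by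
      simp only [map_mul, map_neg, map_add, map_one, map_pow, map_ofNat]
      linear_combination -3 * hxy
    have ne_zero : 3 * PadicInt.toZMod y ≠ 0 := fun h =>
      neg_ne_zero.2 one_ne_zero <| by
        linear_combination -hxy + PadicInt.toZMod x * hx + PadicInt.toZMod y * h
    obtain ⟨w, hw⟩ := isSquare_coe_of_isSquare_toZMod hp₂ (a := -3 * (1 + x ^ 2))
      (toZMod_eq ▸ pow_ne_zero 2 ne_zero) (toZMod_eq ▸ IsSquare.sq _)
    refine ⟨x, w / 3, ?_⟩
    push_cast [coe_three] at hw
    linear_combination -hw / 3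
  · have toZMod_eq : PadicInt.toZMod (-1 - 3 * y ^ 2) = PadicInt.toZMod x ^ 2 := by
      simp only [map_mul, map_neg, map_sub, map_one, map_pow, map_ofNat]
      linear_combination -hxy
    obtain ⟨w, hw⟩ := isSquare_coe_of_isSquare_toZMod hp₂ (a := -1 - 3 * y ^ 2)
      (toZMod_eq ▸ pow_ne_zero 2 hx) (toZMod_eq ▸ IsSquare.sq _)
    refine ⟨w, y, ?_⟩
    push_cast [coe_three] at hw
    linear_combination -hw

/- The field `F` contains a square root of `-1`, `3` or `-3`; in the second case use that `-2` is a
square in `ℚ_[3]`. -/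
theorem exists_sq_add_three_mul_sq_eq_neg_one_of_quadratic {E : Type*} [Field E] [Algebra ℚ_[3] E]
    (F : IntermediateField ℚ_[3] E) (hF : Module.finrank ℚ_[3] F = 2) :
    ∃ x y : E, x ^ 2 + 3 * y ^ 2 = -1 := by
  have : CharZero E := charZero_of_injective_algebraMap (algebraMap ℚ_[3] E).injective
  obtain ⟨y, ⟨d, hd⟩, hy⟩ := exists_sq_mem_range_algebraMap_of_finrank_eq_two hF
  have y_ne_zero : (y : E) ≠ 0 :=
    fun h => hy ⟨0, by rw [map_zero, ← ZeroMemClass.coe_eq_zero.1 h]⟩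
  have hdE : algebraMap ℚ_[3] E d = (y : E) ^ 2 := congrArg (algebraMap F E) hd
  have d_ne_zero : d ≠ 0 := fun h => pow_ne_zero 2 y_ne_zero (by rw [← hdE, h, map_zero])
  obtain ⟨w, hw⟩ := exists_sq_eq_neg_two
  replace hw := congrArg (algebraMap ℚ_[3] E) hw
  rcases isSquare_or_of_padic_three d_ne_zero with ⟨v, hv⟩ | ⟨v, hv⟩ | ⟨v, hv⟩ | ⟨v, hv⟩
  · rw [hv, map_mul, ← sq, eq_comm, sq_eq_sq_iff_eq_or_eq_neg] at hd
    rcases hd with rfl | rfl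
    · exact (hy ⟨v, rfl⟩).elim
    · exact (hy ⟨-v, map_neg _ v⟩).elim
  all_goals
    replace hv := congrArg (algebraMap ℚ_[3] E) hv
    simp only [map_mul, map_neg, map_pow, map_ofNat, hdE] at hv hw
    have v_ne_zero : algebraMap ℚ_[3] E v ≠ 0 := fun h => y_ne_zero <| by simpa [h] using hv
  · exact ⟨algebraMap _ E v / y, 0, by field_simp; linear_combination -hv⟩
  · refine ⟨algebraMap _ E w, y / algebraMap _ E v, ?_⟩
    field_simp
    linear_combination hw * algebraMap _ E v ^ 2 + hv
  · refine ⟨0, y / algebraMap _ E v, ?_⟩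
    field_simp
    linear_combination -hv

theorem exists_sq_eq_two_iff_exists_sq_eq_neg_one {E : Type*} [Field E] [Algebra ℚ_[3] E] :
    (∃ s : E, s ^ 2 = 2) ↔ ∃ s : E, s ^ 2 = -1 := by
  obtain ⟨w, hw⟩ := exists_sq_eq_neg_two
  replace hw := congrArg (algebraMap ℚ_[3] E) hw
  rw [map_pow, map_neg, map_ofNat] at hw
  have : CharZero E := charZero_of_injective_algebraMap (algebraMap ℚ_[3] E).injective
  constructor <;> rintro ⟨s, hs⟩
  · exact ⟨s * algebraMap _ E w / 2, by linear_combination hs * (algebraMap _ E w) ^ 2 / 4 + hw / 2⟩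
  · exact ⟨s * algebraMap _ E w, by linear_combination hs * (algebraMap _ E w) ^ 2 - hw⟩

end PadicSquares

section Splitting

variable {E : Type*} [Field E] [Algebra ℚ E]

/-- The standard generators of `ℍ[ℚ, -3, -1]` in `M₂(E)` given by a solution of
`x ^ 2 + 3 * y ^ 2 = -1`. -/
def matrixQuaternionBasis {x y : E} (hxy : x ^ 2 + 3 * y ^ 2 = -1) :
    QuaternionAlgebra.Basis (Matrix (Fin 2) (Fin 2) E) (-3 : ℚ) 0 (-1) where
  i := !![0, -3; 1, 0]
  j := !![x, 3 * y; y, -x]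
  k := !![-3 * y, 3 * x; x, 3 * y]
  i_mul_i := by
    rw [neg_smul, ofNat_smul_eq_nsmul, nsmul_one, Nat.cast_ofNat]
    ext i j
    fin_cases i <;> fin_cases j <;> simp [Matrix.ofNat_apply]
  j_mul_j := by
    ext i j
    fin_cases i <;> fin_cases j <;> simp <;> grind
  i_mul_j := by
    ext i j
    fin_cases i <;> fin_cases j <;> simp
  j_mul_i := by
    ext i j
    fin_cases i <;> fin_cases j <;> simp <;> ring

/-- The homomorphism of `E`-algebras extending `matrixQuaternionBasis`. -/
noncomputable def matrixQuaternionHom {x y : E} (hxy : x ^ 2 + 3 * y ^ 2 = -1) :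
    E ⊗[ℚ] ℍ[ℚ,-3,-1] →ₐ[E] Matrix (Fin 2) (Fin 2) E :=
  Algebra.TensorProduct.lift (Algebra.ofId E _) (matrixQuaternionBasis hxy).liftHom
    fun a _ => by rw [Algebra.ofId_apply]; exact Algebra.commute_algebraMap_left a _

theorem matrixQuaternionHom_tmul {x y : E} (hxy : x ^ 2 + 3 * y ^ 2 = -1) (e : E) (z : ℍ[ℚ,-3,-1]) :
    matrixQuaternionHom hxy (e ⊗ₜ z) = e • (matrixQuaternionBasis hxy).lift z := by
  rw [matrixQuaternionHom, Algebra.TensorProduct.lift_tmul, Algebra.ofId_apply, Algebra.smul_def]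
  rfl

theorem surjective_matrixQuaternionHom {x y : E} (hxy : x ^ 2 + 3 * y ^ 2 = -1) :
    Function.Surjective (matrixQuaternionHom hxy) := by
  have : CharZero E := algebraRat.charZero E
  intro M
  obtain ⟨t, a, u, v, rfl⟩ : ∃ t a u v, M = !![t + v, 3 * (u - a); u + a, t - v] := by
    refine ⟨(M 0 0 + M 1 1) / 2, (3 * M 1 0 - M 0 1) / 6, (3 * M 1 0 + M 0 1) / 6,
      (M 0 0 - M 1 1) / 2, ?_⟩
    ext i j
    fin_cases i <;> fin_cases j <;> simp <;> ring
  refine ⟨t ⊗ₜ 1 + a ⊗ₜ ⟨0, 1, 0, 0⟩ + (-(x * v + 3 * y * u)) ⊗ₜ ⟨0, 0, 1, 0⟩ +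
    (y * v - x * u) ⊗ₜ ⟨0, 0, 0, 1⟩, ?_⟩
  simp only [map_add, matrixQuaternionHom_tmul, QuaternionAlgebra.Basis.lift,
    matrixQuaternionBasis]
  ext i j
  fin_cases i <;> fin_cases j <;> simp <;> grind

theorem nonempty_algEquiv_matrix {x y : E} (hxy : x ^ 2 + 3 * y ^ 2 = -1) :
    Nonempty ((E ⊗[ℚ] ℍ[ℚ,-3,-1]) ≃ₐ[E] Matrix (Fin 2) (Fin 2) E) := by
  have finrank_eq : Module.finrank E (E ⊗[ℚ] ℍ[ℚ,-3,-1]) =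
      Module.finrank E (Matrix (Fin 2) (Fin 2) E) := by
    rw [Module.finrank_baseChange, QuaternionAlgebra.finrank_eq_four, Module.finrank_matrix,
      Module.finrank_self, Fintype.card_fin]
  have surj := surjective_matrixQuaternionHom hxy
  exact ⟨.ofBijective _ ⟨(LinearMap.injective_iff_surjective_of_finrank_eq_finrank finrank_eq
    (f := (matrixQuaternionHom hxy).toLinearMap)).2 surj, surj⟩⟩

end Splitting

section PadicAlgebra

variable {E : Type*} [Field E] [Algebra ℚ E] {p : ℕ} [Fact p.Prime] [Algebra ℚ_[p] E]

theorem nonempty_algEquiv_matrix_of_padic_algebra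
    (h : p ≠ 3 ∨ ∃ F : IntermediateField ℚ_[p] E, Module.finrank ℚ_[p] F = 2) :
    Nonempty ((E ⊗[ℚ] ℍ[ℚ,-3,-1]) ≃ₐ[E] Matrix (Fin 2) (Fin 2) E) := by
  rcases eq_or_ne p 3 with rfl | hp
  · obtain ⟨F, hF⟩ := h.resolve_left (not_not.2 rfl)
    obtain ⟨x, y, hxy⟩ := exists_sq_add_three_mul_sq_eq_neg_one_of_quadratic F hF
    exact nonempty_algEquiv_matrix hxy
  · obtain ⟨x, y, hxy⟩ := exists_sq_add_three_mul_sq_eq_neg_one hp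
    refine nonempty_algEquiv_matrix (x := algebraMap _ E x) (y := algebraMap _ E y) ?_
    simpa only [map_add, map_mul, map_pow, map_ofNat, map_neg, map_one] using
      congrArg (algebraMap ℚ_[p] E) hxy

theorem card_integralForms_localIntegers_eq_one [Algebra.IsAlgebraic ℚ_[p] E]
    (φ : (E ⊗[ℚ] ℍ[ℚ,-3,-1]) ≃ₐ[E] Matrix (Fin 2) (Fin 2) E)
    (h : p = 3 → ¬ ∃ s : E, s ^ 2 = 2) :
    ENat.card (IntegralForms (localIntegers p E) (dicyclicRep φ)) = 1 := by
  refine card_integralForms_eq_one (dicyclicPair_dicyclicRep φ) fun a b hab => ?_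
  rcases eq_or_ne p 3 with rfl | hp
  · refine h rfl (exists_sq_eq_two_iff_exists_sq_eq_neg_one.2 ?_)
    exact localIntegers.exists_sq_eq_neg_one_of_residueField (by decide) (sq b ▸ hab.p_mul_p)
  · have coprime : p.Coprime 3 := (Nat.coprime_primes Fact.out Nat.prime_three).2 hp
    have three_unit := (localIntegers.isUnit_natCast_iff (E := E)).2 coprime
    refine (three_unit.map (IsLocalRing.residue _)).ne_zero ?_
    rw [map_natCast, Nat.cast_ofNat, hab.three_eq_zero]

theorem card_integralForms_localIntegers_eq_localRamificationIndex_add_one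
    [Algebra ℚ_[3] E] [Algebra.IsAlgebraic ℚ_[3] E] {t : E} (ht : t ^ 2 = 2)
    (φ : (E ⊗[ℚ] ℍ[ℚ,-3,-1]) ≃ₐ[E] Matrix (Fin 2) (Fin 2) E) :
    ENat.card (IntegralForms (localIntegers 3 E) (dicyclicRep φ)) =
      localRamificationIndex 3 E + 1 := by
  obtain ⟨s, hs⟩ := exists_sq_eq_two_iff_exists_sq_eq_neg_one.1 ⟨t, ht⟩
  have s_mem : s ∈ localIntegers 3 E :=
    localIntegers.mem_of_sq_mem (hs ▸ neg_mem (one_mem _))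
  have two_unit : IsUnit ((2 : ℕ) : localIntegers 3 E) :=
    localIntegers.isUnit_natCast_iff.2 (by decide)
  obtain ⟨half, two_mul_half⟩ := two_unit.exists_right_inv
  have : CharZero E := algebraRat.charZero E
  rw [card_integralForms_eq_card_divisors three_ne_zero (dicyclicPair_dicyclicRep φ)
    (mod_cast two_mul_half) (s := ⟨s, s_mem⟩) (Subtype.ext hs), ← localIntegers.card_divisors_p]
  rfl

end PadicAlgebra

theorem theorem4_general (p : ℕ) [Fact p.Prime] (E : Type*) [Field E] [Algebra ℚ E]
    [Algebra ℚ_[p] E] [Algebra.IsAlgebraic ℚ_[p] E] :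
    ((p ≠ 3 ∨ ∃ F : IntermediateField ℚ_[p] E, Module.finrank ℚ_[p] F = 2) →
      Nonempty ((E ⊗[ℚ] ℍ[ℚ,-3,-1]) ≃ₐ[E] Matrix (Fin 2) (Fin 2) E)) ∧
    ∀ φ : (E ⊗[ℚ] ℍ[ℚ,-3,-1]) ≃ₐ[E] Matrix (Fin 2) (Fin 2) E,
      ((p = 3 ∧ ∃ s : E, s ^ 2 = 2) →
        ENat.card (IntegralForms (localIntegers p E) (dicyclicRep φ)) =
          localRamificationIndex p E + 1) ∧
      ((p = 3 → ¬ ∃ s : E, s ^ 2 = 2) →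
        ENat.card (IntegralForms (localIntegers p E) (dicyclicRep φ)) = 1) := by
  refine ⟨nonempty_algEquiv_matrix_of_padic_algebra, fun φ =>
    ⟨?_, card_integralForms_localIntegers_eq_one φ⟩⟩
  rintro ⟨rfl, t, ht⟩
  exact card_integralForms_localIntegers_eq_localRamificationIndex_add_one ht φ

theorem theorem4 :
    (∀ (E : Type*) [Field E] [Algebra ℚ E] [Algebra ℚ_[3] E],
      IsGalois ℚ_[3] E →
      (∃ F : IntermediateField ℚ_[3] E, Module.finrank ℚ_[3] F = 2) →
      Nonempty ((E ⊗[ℚ] ℍ[ℚ, -3, -1]) ≃ₐ[E] Matrix (Fin 2) (Fin 2) E) ∧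
      ∀ φ : (E ⊗[ℚ] ℍ[ℚ, -3, -1]) ≃ₐ[E] Matrix (Fin 2) (Fin 2) E,
        ((∃ s : E, s ^ 2 = 2) →
          ENat.card (IntegralForms (localIntegers 3 E) (dicyclicRep φ)) =
            localRamificationIndex 3 E + 1) ∧
        ((¬ ∃ s : E, s ^ 2 = 2) →
          ENat.card (IntegralForms (localIntegers 3 E) (dicyclicRep φ)) = 1)) ∧
    (∀ (p : ℕ) [Fact p.Prime], p ≠ 3 →
      ∀ (E : Type*) [Field E] [Algebra ℚ E] [Algebra ℚ_[p] E],
      Algebra.IsAlgebraic ℚ_[p] E →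
      Nonempty ((E ⊗[ℚ] ℍ[ℚ, -3, -1]) ≃ₐ[E] Matrix (Fin 2) (Fin 2) E) ∧
      ∀ φ : (E ⊗[ℚ] ℍ[ℚ, -3, -1]) ≃ₐ[E] Matrix (Fin 2) (Fin 2) E,
        ENat.card (IntegralForms (localIntegers p E) (dicyclicRep φ)) = 1) :=
  ⟨fun E _ _ _ _ hF => (theorem4_general 3 E).imp (· (.inr hF)) fun card φ =>
      (card φ).imp (· ⟨rfl, ·⟩) fun card_eq_one hs => card_eq_one fun _ => hs,
    fun p _ hp E _ _ _ _ => (theorem4_general p E).imp (· (.inl hp)) fun card φ =>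
      (card φ).2 fun h => absurd h hp⟩
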